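/- Let $\Omega\subset\mathbb R^d$ be a bounded, connected, open set and consider the $L^1$-gradient flow of the Dirichlet energy $\Phi(u)=\frac12\int_\Omega|Du|^2dx$ with domain $V$, where either $V=H^1(\Omega)$ (homogeneous Neumann boundary conditions) or $V=H^1_0(\Omega)$ (homogeneous Dirichlet boundary conditions). Let $u^0\in V$ and let $u\in C^0([0,+\infty);V)$, with $u(0)=u^0$ and time derivative $\dot u\in L^2_{\mathrm{loc}}((0,+\infty);L^1(\Omega))$, be a solution of the flow equations: for a.e. $t>0$, $\Delta u(t)\in L^\infty(\Omega)$ and $$|\Delta u|\le \|\dot u\|_{L^1(\Omega)}\quad\text{and}\quad \dot u\,\Delta u=|\dot u|\,\|\dot u\|_{L^1(\Omega)}\qquad\text{a.e. in }\Omega,$$ where $\Delta u(t)$ is understood weakly with test functions in $V$, that is, $\int_\Omega Du(t)\cdot D\varphi\,dx=-\int_\Omega \Delta u(t)\,\varphi\,dx$ for all $\varphi\in V$. Then, for every $t>0$, $$\int_\Omega|Du(t)|^2dx\le e^{-t/c_\Omega}\int_\Omega|Du^0|^2dx,$$ where $c_\Omega$ is the best constant in the Poincaré–Wirtinger inequality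 $$\Big(\int_\Omega|w-m_w|\,dx\Big)^2\le c_\Omega\int_\Omega|Dw|^2dx\quad\forall\,w\in H^1(\Omega),\qquad m_w=\frac1{|\Omega|}\int_\Omega w\,dx,$$ in the Neumann case, respectively in the Poincaré inequality $\big(\int_\Omega|w|\,dx\big)^2\le c_\Omega\int_\Omega|Dw|^2dx$ for all $w\in H^1_0(\Omega)$ in the Dirichlet case. (If no finite constant exists, $c_\Omega=+\infty$ and $e^{-t/c_\Omega}=1$.) -/

import Mathlib

open MeasureTheory Set
open scoped ENNReal

noncomputable section

/-- `ℝᵈ` with its Euclidean norm. -/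
abbrev Rd (d : ℕ) : Type := EuclideanSpace ℝ (Fin d)

/-- Pairs `(w, G)` with `w ∈ L²(Ω)` and `G ∈ L²(Ω; ℝᵈ)`. A Sobolev function `w ∈ H¹(Ω)` is
represented by the pair `(w, Dw)`; the topology of the product is then that of `H¹(Ω)`. -/
abbrev L2Pair {d : ℕ} (Ω : Set (Rd d)) : Type :=
  Lp ℝ 2 (volume.restrict Ω) × Lp (Rd d) 2 (volume.restrict Ω)

/-- Test functions: `φ ∈ C_c^∞(Ω)`. -/
def IsTestFunction {d : ℕ} (Ω : Set (Rd d)) (φ : Rd d → ℝ) : Prop :=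
  ContDiff ℝ ((⊤ : ℕ∞) : WithTop ℕ∞) φ ∧ HasCompactSupport φ ∧ tsupport φ ⊆ Ω

/-- `H¹(Ω)`: the pairs `(w, Dw)` where `Dw ∈ L²(Ω; ℝᵈ)` is the weak gradient of `w ∈ L²(Ω)`. -/
def H1 {d : ℕ} (Ω : Set (Rd d)) : Set (L2Pair Ω) :=
  {p | ∀ φ : Rd d → ℝ, IsTestFunction Ω φ →
    ∫ x in Ω, p.1 x • gradient φ x = - ∫ x in Ω, φ x • p.2 x}

/-- `H¹₀(Ω)`: the closure of `C_c^∞(Ω)` in the `H¹` topology. -/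
def H10 {d : ℕ} (Ω : Set (Rd d)) : Set (L2Pair Ω) :=
  closure {p | ∃ φ : Rd d → ℝ, IsTestFunction Ω φ ∧
    p.1 =ᵐ[volume.restrict Ω] φ ∧ p.2 =ᵐ[volume.restrict Ω] gradient φ}

/-- `∫_Ω |Dw|² dx`. -/
def gradEnergy {d : ℕ} {Ω : Set (Rd d)} (p : L2Pair Ω) : ℝ :=
  ∫ x in Ω, ‖p.2 x‖ ^ 2

/-- `g ∈ L^∞(Ω)` is the Laplacian of the function `w` represented by `p`, in the weak form with
test functions in `V`: `∫_Ω Dw · Dφ = - ∫_Ω g φ` for every `φ ∈ V`. For `V = H¹₀(Ω)` this is the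
distributional Laplacian; for `V = H¹(Ω)` it includes the homogeneous Neumann condition. -/
def IsWeakLaplacian {d : ℕ} {Ω : Set (Rd d)} (V : Set (L2Pair Ω)) (p : L2Pair Ω)
    (g : Lp ℝ ⊤ (volume.restrict Ω)) : Prop :=
  ∀ q ∈ V, ∫ x in Ω, inner ℝ (p.2 x) (q.2 x) = - ∫ x in Ω, g x * q.1 x

/-- `v` is the time derivative of `u` on `(0, ∞) × Ω`, with `v ∈ L²_loc((0, ∞); L¹(Ω))`:
`u(t) - u(s) = ∫_s^t v(r) dr` (Bochner integral in `L¹(Ω)`) whenever `0 < s ≤ t`. -/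
def IsTimeDeriv {d : ℕ} {Ω : Set (Rd d)} (u : ℝ → L2Pair Ω)
    (v : ℝ → Lp ℝ 1 (volume.restrict Ω)) : Prop :=
  (∀ a b : ℝ, 0 < a → a ≤ b → MemLp v 2 (volume.restrict (Icc a b))) ∧
  ∀ s t : ℝ, 0 < s → s ≤ t →
    (fun x => (u t).1 x - (u s).1 x) =ᵐ[volume.restrict Ω]
      ((∫ r in s..t, v r : Lp ℝ 1 (volume.restrict Ω)) : Rd d → ℝ)

/-- `u` solves the `L¹`-gradient flow equation of the Dirichlet energy with domain `V`
(`V = H¹(Ω)`: Neumann; `V = H¹₀(Ω)`: Dirichlet) and initial datum `u₀`: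
`u ∈ C⁰([0, ∞); V)`, `u(0) = u₀`, and for a.e. `t > 0`, a.e. in `Ω`,
`|Δu| ≤ ‖u̇‖₁` and `u̇ Δu = |u̇| ‖u̇‖₁`. -/
structure IsL1DirichletFlow {d : ℕ} (Ω : Set (Rd d)) (V : Set (L2Pair Ω)) (u₀ : L2Pair Ω)
    (u : ℝ → L2Pair Ω) : Prop where
  mem : ∀ t : ℝ, 0 ≤ t → u t ∈ V
  cont : ContinuousOn u (Ici 0)
  init : u 0 = u₀
  eqn : ∃ v : ℝ → Lp ℝ 1 (volume.restrict Ω), IsTimeDeriv u v ∧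
    ∀ᵐ t ∂(volume.restrict (Ioi (0 : ℝ))),
      ∃ g : Lp ℝ ⊤ (volume.restrict Ω), IsWeakLaplacian V (u t) g ∧
        (∀ᵐ x ∂(volume.restrict Ω), |g x| ≤ ‖v t‖) ∧
        (∀ᵐ x ∂(volume.restrict Ω), v t x * g x = |v t x| * ‖v t‖)

/-- The Poincaré–Wirtinger constant: the least `c ∈ [0, ∞]` such that
`‖w - m‖²_{L¹(Ω)} ≤ c ∫_Ω |Dw|²` for all `w ∈ H¹(Ω)`, where `m` is the mean value of `w`. -/
def poincareWirtingerConst {d : ℕ} (Ω : Set (Rd d)) : ℝ≥0∞ :=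
  sInf {c : ℝ≥0∞ | ∀ w ∈ H1 Ω,
    (∫⁻ x in Ω, ‖w.1 x - ⨍ y in Ω, w.1 y‖ₑ) ^ 2 ≤ c * ∫⁻ x in Ω, ‖w.2 x‖ₑ ^ 2}

/-- The Poincaré constant: the least `c ∈ [0, ∞]` such that
`‖w‖²_{L¹(Ω)} ≤ c ∫_Ω |Dw|²` for all `w ∈ H¹₀(Ω)`. -/
def poincareConst {d : ℕ} (Ω : Set (Rd d)) : ℝ≥0∞ :=
  sInf {c : ℝ≥0∞ | ∀ w ∈ H10 Ω,
    (∫⁻ x in Ω, ‖w.1 x‖ₑ) ^ 2 ≤ c * ∫⁻ x in Ω, ‖w.2 x‖ₑ ^ 2}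

end

open Filter Topology

/-! Write `D(t) = ∫|Du(t)|²` and `v = u̇`. Convexity and the weak Laplacian give `D(t) - D(s) ≤ -2 ∫
Δu(t) (u(t) - u(s))`. Replacing `u(t) - u(s)` by `(t - s) v(t)` turns the right side into `-2 (t -
s) ‖v(t)‖²`, with an error at most `2 ‖v(t)‖ ∫_s^t ‖v(r) - v(t)‖ dr`
(`IsWeakLaplacian.gradEnergy_sub_le`). No differentiability of `D` is needed: take `s = t - η`,
integrate in `t`, divide by `η` and let `η → 0`. The error vanishes because translations are
continuous in `L²`, leaving `D(b) - D(a) ≤ -2 ∫_a^b ‖v‖²` (`sub_le_neg_two_mul_integral_sq`).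
Testing the equation with `u`, minus its mean in the Neumann case, gives `D ≤ ‖v‖ ‖u - m‖₁ ≤ ‖v‖ √(c
D)`, so `D / c ≤ ‖v‖²` (`inv_toReal_mul_gradEnergy_le`). A Gronwall argument concludes
(`le_exp_mul_of_dissipation`). -/

/-! ### Integrating a slope inequality in time -/

/-- Continuity of translations in `L²(ℝ; X)`. -/
theorem tendsto_eLpNorm_translate_sub {X : Type*} [NormedAddCommGroup X] {w : ℝ → X}
    (hw : MemLp w 2 volume) :
    Tendsto (fun s : ℝ => eLpNorm (fun t => w (t - s) - w t) 2 volume) (𝓝 0) (𝓝 0) := by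
  have : Fact ((2 : ℝ≥0∞) ≠ ∞) := ⟨by simp⟩
  have hc : Continuous fun s : ℝ => (DomAddAct.mk (-s) +ᵥ hw.toLp w : Lp X 2 volume) := by
    have : Continuous fun s : ℝ => DomAddAct.mk (-s) :=
      DomAddAct.continuous_mk.comp continuous_neg
    exact this.vadd continuous_const
  have h1 : Tendsto (fun s : ℝ => edist (DomAddAct.mk (-s) +ᵥ hw.toLp w : Lp X 2 volume)
      (hw.toLp w)) (𝓝 0) (𝓝 0) := by
    have := (hc.edist (continuous_const (y := hw.toLp w))).tendsto 0
    simpa using this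
  refine h1.congr fun s => ?_
  rw [DomAddAct.mk_vadd_toLp, Lp.edist_toLp_toLp]
  congr 1
  ext t
  simp [sub_eq_neg_add]

/-- The mean oscillation of `w` over short intervals, weighted by `‖w‖`. -/
theorem eventually_lintegral_mul_oscillation_le {X : Type*} [NormedAddCommGroup X] {w : ℝ → X}
    (hw : MemLp w 2 volume) {ε : ℝ≥0∞} (hε : 0 < ε) :
    ∀ᶠ h : ℝ in 𝓝[>] 0, ∫⁻ t, ‖w t‖ₑ * ∫⁻ r in Ioc (t - h) t, ‖w r - w t‖ₑ ≤
      ENNReal.ofReal h * (eLpNorm w 2 volume * ε) := by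
  have h1 := (tendsto_eLpNorm_translate_sub hw).eventually (ge_mem_nhds hε)
  obtain ⟨δ, hδ, hδ'⟩ := Metric.eventually_nhds_iff.1 h1
  filter_upwards [Ioo_mem_nhdsGT hδ] with h hh
  -- With `r = t - s` the inner domain no longer depends on `t`; Tonelli and Cauchy–Schwarz in `t`
  -- then apply for each fixed shift `s`.
  have hsub (t : ℝ) : ∫⁻ r in Ioc (t - h) t, ‖w r - w t‖ₑ =
      ∫⁻ s in Ico 0 h, ‖w (t - s) - w t‖ₑ := by
    have := (Measure.measurePreserving_sub_left (volume : Measure ℝ) t).setLIntegral_comp_preimage_emb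
      (MeasurableEquiv.subLeft t).measurableEmbedding (fun r => ‖w r - w t‖ₑ) (Ioc (t - h) t)
    rw [← this]
    congr 2
    ext s
    simp only [mem_preimage, mem_Ioc, mem_Ico]
    constructor <;> rintro ⟨h1, h2⟩ <;> constructor <;> linarith
  have hm : AEStronglyMeasurable (fun p : ℝ × ℝ => w (p.1 - p.2))
      ((volume : Measure ℝ).prod (volume.restrict (Ico 0 h))) :=
    (hw.1.mono_ac (quasiMeasurePreserving_sub_of_right_invariant volume _).absolutelyContinuous).comp_measurable
      measurable_sub
  have hm1 : AEStronglyMeasurable (fun p : ℝ × ℝ => w p.1)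
      ((volume : Measure ℝ).prod (volume.restrict (Ico 0 h))) := hw.1.comp_fst
  calc ∫⁻ t, ‖w t‖ₑ * ∫⁻ r in Ioc (t - h) t, ‖w r - w t‖ₑ
      ≤ ∫⁻ t, ∫⁻ s in Ico 0 h, ‖w t‖ₑ * ‖w (t - s) - w t‖ₑ := by
        refine lintegral_mono fun t => ?_
        rw [hsub, lintegral_const_mul' _ _ enorm_ne_top]
    _ = ∫⁻ s in Ico 0 h, ∫⁻ t, ‖w t‖ₑ * ‖w (t - s) - w t‖ₑ :=
        lintegral_lintegral_swap (hm1.enorm.mul (hm.sub hm1).enorm)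
    _ ≤ ∫⁻ s in Ico 0 h, eLpNorm w 2 volume * ε := by
        refine setLIntegral_mono' measurableSet_Ico fun s hs => ?_
        have hs' : AEStronglyMeasurable (fun t => w (t - s)) volume :=
          hw.1.comp_measurePreserving (measurePreserving_sub_right volume s)
        have := ENNReal.lintegral_mul_le_Lp_mul_Lq volume Real.HolderConjugate.two_two
          hw.1.enorm (hs'.sub hw.1).enorm
        refine this.trans ?_
        have e (f : ℝ → X) : (∫⁻ t, ‖f t‖ₑ ^ (2 : ℝ)) ^ (1 / (2 : ℝ)) = eLpNorm f 2 volume := by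
          rw [eLpNorm_eq_lintegral_rpow_enorm_toReal (by simp) (by simp)]; simp
        have e2 := e (fun t => w (t - s) - w t)
        simp only [Pi.sub_apply]
        rw [e w, e2]
        gcongr
        apply hδ'
        rw [Real.dist_0_eq_abs, abs_of_nonneg hs.1]
        exact hs.2.trans hh.2
    _ = _ := by
        rw [setLIntegral_const, Real.volume_Ico, sub_zero, mul_comm]

/-- A one-sided slope inequality integrates to the energy dissipation inequality. -/
theorem sub_le_neg_two_mul_integral_sq {X : Type*} [NormedAddCommGroup X]
    {D : ℝ → ℝ} (hD : ContinuousOn D (Ioi 0)) {v : ℝ → X}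
    (hv : ∀ a b : ℝ, 0 < a → a ≤ b → MemLp v 2 (volume.restrict (Icc a b)))
    (h : ∀ᵐ t ∂(volume.restrict (Ioi (0 : ℝ))), ∀ s, 0 < s → s ≤ t →
      D t - D s ≤ -2 * (t - s) * ‖v t‖ ^ 2 + 2 * (‖v t‖ * ∫ r in s..t, ‖v r - v t‖))
    {a b : ℝ} (ha : 0 < a) (hab : a ≤ b) :
    D b - D a ≤ -2 * ∫ t in a..b, ‖v t‖ ^ 2 := by
  -- The cutoff makes `v` globally `L²`; starting at `a / 2` keeps every window `(t - η, t]` with `t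
  -- ∈ (a, b]`, `η < a / 2` inside the region where `w = v`.
  set w : ℝ → X := (Icc (a / 2) b).indicator v
  have hw : MemLp w 2 volume :=
    (memLp_indicator_iff_restrict measurableSet_Icc).2 (hv _ _ (by linarith) (by linarith))
  set A := (eLpNorm w 2 volume).toReal
  have hwv : ∀ t ∈ Icc (a / 2) b, w t = v t := fun t ht => indicator_of_mem ht _
  have key : ∀ ε > 0, D b - D a - 2 * ε + 2 * ∫ t in a..b, ‖v t‖ ^ 2 ≤ 2 * (A * ε) := by
    intro ε hε
    have c (x : ℝ) (hx : 0 < x) : ∀ᶠ h : ℝ in 𝓝[>] 0, ∀ t ∈ Icc (x - h) x, |D t - D x| ≤ ε := by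
      have h1 := Metric.continuousAt_iff.1 (hD.continuousAt (Ioi_mem_nhds hx)) ε hε
      obtain ⟨δ, hδ, h2⟩ := h1
      filter_upwards [Ioo_mem_nhdsGT hδ] with h hh t ht
      refine (h2 ?_).le
      rw [Real.dist_eq, abs_lt]
      constructor <;> linarith [ht.1, ht.2, hh.2]
    obtain ⟨η, h1, h2, h3, h4, h5⟩ := ((eventually_lintegral_mul_oscillation_le hw
      (ENNReal.ofReal_pos.2 hε)).and ((c a ha).and ((c b (ha.trans_le hab)).and
      ((Ioo_mem_nhdsGT (half_pos ha) : ∀ᶠ h : ℝ in 𝓝[>] 0, h ∈ Ioo 0 (a / 2)))))).exists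
    set F : ℝ → ℝ := fun t => D t - D (t - η) + 2 * η * ‖v t‖ ^ 2
    have hDi (x y : ℝ) (hx : 0 < x) (hy : 0 < y) : IntervalIntegrable D volume x y :=
      (hD.mono fun z hz => (lt_min hx hy).trans_le hz.1).intervalIntegrable
    have hvi : IntervalIntegrable (fun t => ‖v t‖ ^ 2) volume a b := by
      rw [intervalIntegrable_iff_integrableOn_Icc_of_le hab]
      exact (hv a b ha hab).integrable_norm_pow (by norm_num)
    have hDη : IntervalIntegrable (fun t => D (t - η)) volume a b := by
      simpa using (hDi (a - η) (b - η) (by linarith) (by linarith)).comp_sub_right η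
    -- The difference quotient telescopes to averages of `D` near `b` and near `a`, each within `ε`
    -- of the endpoint value: hence the `2 * ε` in `key`.
    have hF : ∫ t in a..b, F t = (∫ t in (b - η)..b, D t) - (∫ t in (a - η)..a, D t)
        + 2 * η * ∫ t in a..b, ‖v t‖ ^ 2 := by
      rw [intervalIntegral.integral_add ((hDi a b ha (by linarith)).sub hDη) (hvi.const_mul _),
        intervalIntegral.integral_sub (hDi a b ha (by linarith)) hDη,
        intervalIntegral.integral_const_mul, intervalIntegral.integral_comp_sub_right]
      have e1 := intervalIntegral.integral_add_adjacent_intervals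
        (hDi (a - η) a (by linarith) ha) (hDi a b ha (by linarith))
      have e2 := intervalIntegral.integral_add_adjacent_intervals
        (hDi (a - η) (b - η) (by linarith) (by linarith)) (hDi (b - η) b (by linarith) (by linarith))
      linarith
    have lb : η * (D b - ε) ≤ ∫ t in (b - η)..b, D t := by
      have := intervalIntegral.integral_mono_on (a := b - η) (b := b) (f := fun _ => D b - ε)
        (by linarith) (by simp) (hDi _ _ (by linarith) (by linarith))
        fun t ht => by linarith [(abs_le.1 (h3 t ht)).1]
      simpa [mul_sub] using this
    have ub : ∫ t in (a - η)..a, D t ≤ η * (D a + ε) := by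
      have := intervalIntegral.integral_mono_on (a := a - η) (b := a) (g := fun _ => D a + ε)
        (by linarith) (hDi _ _ (by linarith) (by linarith)) (by simp)
        fun t ht => by linarith [(abs_le.1 (h2 t ht)).2]
      simpa [mul_add] using this
    have err : ∫ t in a..b, F t ≤ η * (2 * (A * ε)) := by
      -- Lower integrals spare any measurability or integrability check for the oscillation term.
      have hbound : ∫⁻ t in Ioc a b, ENNReal.ofReal (F t) ≤ ENNReal.ofReal (η * (2 * (A * ε))) := by
        calc ∫⁻ t in Ioc a b, ENNReal.ofReal (F t)
            ≤ ∫⁻ t in Ioc a b, 2 * (‖w t‖ₑ * ∫⁻ r in Ioc (t - η) t, ‖w r - w t‖ₑ) := by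
              refine lintegral_mono_ae ?_
              have hsub : Ioc a b ⊆ Ioi 0 := fun t ht => ha.trans ht.1
              filter_upwards [ae_restrict_mem measurableSet_Ioc, ae_restrict_of_ae_restrict_of_subset hsub h]
                with t ht h
              have hF : F t ≤ 2 * (‖v t‖ * ∫ r in (t - η)..t, ‖v r - v t‖) := by
                have := h (t - η) (by linarith [ht.1]) (by linarith)
                simp only [F]
                nlinarith
              refine (ENNReal.ofReal_le_ofReal hF).trans ?_
              rw [ENNReal.ofReal_mul (by norm_num), ENNReal.ofReal_mul (norm_nonneg _),
                ofReal_norm, hwv t ⟨by linarith [ht.1], ht.2⟩, ENNReal.ofReal_ofNat]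
              gcongr
              rw [intervalIntegral.integral_of_le (by linarith)]
              refine (Real.ofReal_le_enorm _).trans ((enorm_integral_le_lintegral_enorm _).trans ?_)
              refine setLIntegral_mono' measurableSet_Ioc fun r hr => ?_
              rw [enorm_norm, hwv r ⟨by linarith [ht.1, hr.1], hr.2.trans ht.2⟩]
          _ ≤ ∫⁻ t, 2 * (‖w t‖ₑ * ∫⁻ r in Ioc (t - η) t, ‖w r - w t‖ₑ) :=
              setLIntegral_le_lintegral _ _
          _ ≤ 2 * (ENNReal.ofReal η * (eLpNorm w 2 volume * ENNReal.ofReal ε)) := by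
              rw [lintegral_const_mul' _ _ (by simp)]
              gcongr
          _ = _ := by
              rw [← ENNReal.ofReal_toReal hw.2.ne, ← ENNReal.ofReal_mul ENNReal.toReal_nonneg,
                ← ENNReal.ofReal_mul h4.le, ← ENNReal.ofReal_ofNat 2, ← ENNReal.ofReal_mul zero_le_two]
              congr 1
              simp only [A, ENNReal.ofReal_ofNat]
              ring
      have hpos : 0 ≤ η * (2 * (A * ε)) :=
        mul_nonneg h4.le (mul_nonneg zero_le_two (mul_nonneg ENNReal.toReal_nonneg hε.le))
      rw [intervalIntegral.integral_of_le hab, integral_eq_lintegral_pos_part_sub_lintegral_neg_part]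
      · refine (sub_le_self _ ENNReal.toReal_nonneg).trans ?_
        exact ENNReal.toReal_le_of_le_ofReal hpos hbound
      · exact (((hDi a b ha (by linarith)).sub hDη).add (hvi.const_mul _)).1
    have : η * (D b - D a - 2 * ε + 2 * ∫ t in a..b, ‖v t‖ ^ 2) ≤ η * (2 * (A * ε)) := by
      nlinarith
    exact le_of_mul_le_mul_left this h4
  have lim : Tendsto (fun ε : ℝ => 2 * (A * ε) + 2 * ε) (𝓝[>] 0) (𝓝 0) := by
    have : Continuous fun ε : ℝ => 2 * (A * ε) + 2 * ε := by fun_prop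
    simpa using (this.tendsto 0).mono_left nhdsWithin_le_nhds
  have := ge_of_tendsto (b := D b - D a + 2 * ∫ t in a..b, ‖v t‖ ^ 2) lim
    (by filter_upwards [self_mem_nhdsWithin] with ε hε; linarith [key ε hε])
  linarith

/-! ### Gronwall-type decay -/

/-- Exponential decay of an energy whose dissipation controls it. -/
theorem le_exp_mul_of_dissipation {D : ℝ → ℝ} (hD0 : ∀ t, 0 ≤ D t) {k : ℝ} (hk : 0 ≤ k)
    {ρ : ℝ → ℝ} (hρ : ∀ a b : ℝ, 0 < a → a ≤ b → IntervalIntegrable ρ volume a b)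
    (hρD : ∀ᵐ t ∂(volume.restrict (Ioi (0 : ℝ))), k * D t ≤ ρ t)
    (h : ∀ a b : ℝ, 0 < a → a ≤ b → D b - D a ≤ -2 * ∫ t in a..b, ρ t)
    {a b : ℝ} (ha : 0 < a) (hab : a ≤ b) :
    D b ≤ Real.exp (-(k * (b - a))) * D a := by
  have hsub (a b : ℝ) (ha : 0 < a) : ∀ᵐ t ∂(volume.restrict (Ioc a b)), k * D t ≤ ρ t :=
    ae_restrict_of_ae_restrict_of_subset (fun t ht => ha.trans ht.1) hρD
  have anti (a b : ℝ) (ha : 0 < a) (hab : a ≤ b) : D b ≤ D a := by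
    have : 0 ≤ ∫ t in a..b, ρ t := by
      rw [intervalIntegral.integral_of_le hab]
      refine integral_nonneg_of_ae ?_
      filter_upwards [hsub a b ha] with t ht using (mul_nonneg hk (hD0 t)).trans ht
    linarith [h a b ha hab]
  -- On a short interval monotonicity gives `ρ ≥ k * D b`, so `(1 + 2x) D b ≤ D a` with `x = k (b -
  -- a)`. The factor 2 in the dissipation is spent on `exp x ≤ 1 + 2x`, valid for `0 ≤ x ≤ 1`; this
  -- gives rate `k`, not `2k`.
  have step (a b : ℝ) (ha : 0 < a) (hab : a ≤ b) (h1 : k * (b - a) ≤ 1) :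
      D b ≤ Real.exp (-(k * (b - a))) * D a := by
    have hint : (b - a) * (k * D b) ≤ ∫ t in a..b, ρ t := by
      have : ∫ t in a..b, k * D b ≤ ∫ t in a..b, ρ t := by
        rw [intervalIntegral.integral_of_le hab, intervalIntegral.integral_of_le hab]
        refine integral_mono_ae (integrable_const _) (hρ a b ha hab).1 ?_
        filter_upwards [hsub a b ha, ae_restrict_mem measurableSet_Ioc] with t ht ht'
        exact (mul_le_mul_of_nonneg_left (anti t b (ha.trans ht'.1) ht'.2) hk).trans ht
      simpa only [intervalIntegral.integral_const, smul_eq_mul] using this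
    have h2 := h a b ha hab
    set x := k * (b - a)
    have hx : 0 ≤ x := mul_nonneg hk (by linarith)
    have h3 : (1 + 2 * x) * D b ≤ D a := by
      have : (b - a) * (k * D b) = x * D b := by simp only [x]; ring
      linarith
    have h4 : Real.exp x ≤ 1 + 2 * x := by
      have := Real.abs_exp_sub_one_le (x := x) (by rwa [abs_of_nonneg hx])
      rw [abs_of_nonneg hx] at this
      linarith [(abs_le.1 this).2]
    rw [Real.exp_neg, ← div_eq_inv_mul, le_div_iff₀ (Real.exp_pos _)]
    nlinarith [hD0 b]
  -- Longer intervals are shortened from the right by pieces of length `1 / k`.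
  have ind (n : ℕ) : ∀ a b : ℝ, 0 < a → a ≤ b → k * (b - a) ≤ n →
      D b ≤ Real.exp (-(k * (b - a))) * D a := by
    induction n with
    | zero =>
      intro a b ha hab h1
      exact step a b ha hab (h1.trans (by simp))
    | succ n ih =>
      intro a b ha hab h1
      by_cases h0 : k * (b - a) ≤ 1
      · exact step a b ha hab h0
      have hkp : 0 < k := by
        refine lt_of_le_of_ne hk fun h => h0 ?_
        simp [← h]
      push_cast at h1
      have e : k * (b - (b - 1 / k)) = 1 := by field_simp; ring
      have e' : k * (b - 1 / k - a) = k * (b - a) - 1 := by field_simp; ring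
      have hc : a ≤ b - 1 / k := by
        have : 0 ≤ k * (b - 1 / k - a) := by linarith [not_le.1 h0]
        linarith [nonneg_of_mul_nonneg_right this hkp]
      have s1 := step (b - 1 / k) b (ha.trans_le hc) (by have := one_div_pos.2 hkp; linarith) e.le
      have s2 := ih a (b - 1 / k) ha hc (by linarith)
      rw [e] at s1
      rw [e'] at s2
      calc D b ≤ _ := s1
        _ ≤ Real.exp (-1) * (Real.exp (-(k * (b - a) - 1)) * D a) := by gcongr
        _ = _ := by rw [← mul_assoc, ← Real.exp_add]; congr 2; ring
  obtain ⟨n, hn⟩ := exists_nat_ge (k * (b - a))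
  exact ind n a b ha hab hn

/-! ### Dirichlet energy and weak Laplacian -/

section Space

variable {d : ℕ} {Ω : Set (Rd d)}

/-- The integral of the gradient of a test function vanishes. -/
theorem IsTestFunction.integral_gradient {φ : Rd d → ℝ} (hφ : IsTestFunction Ω φ) :
    ∫ x in Ω, gradient φ x = 0 := by
  obtain ⟨h1, h2, h3⟩ := hφ
  have hd : Differentiable ℝ φ := h1.differentiable (by simp)
  have hc : Continuous (fderiv ℝ φ) := h1.continuous_fderiv (by simp)
  have hi : Integrable (fderiv ℝ φ) volume := hc.integrable_of_hasCompactSupport (h2.fderiv ℝ)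
  have h0 : ∫ x, fderiv ℝ φ x = 0 := by
    ext v
    rw [ContinuousLinearMap.integral_apply hi]
    -- Integration by parts against the constant 1.
    have := integral_mul_fderiv_eq_neg_fderiv_mul_of_integrable (μ := (volume : Measure (Rd d)))
      (f := fun _ => (1 : ℝ)) (g := φ) (v := v) (by simp)
      (by simpa using hi.apply_continuousLinearMap v)
      (by simpa using h1.continuous.integrable_of_hasCompactSupport h2)
      (by simp) (fun x _ => hd x)
    simpa using this
  rw [setIntegral_eq_integral_of_forall_compl_eq_zero]
  · have := (InnerProductSpace.toDual ℝ (Rd d)).symm.toLinearIsometry.integral_comp_comm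
      (μ := volume) (fderiv ℝ φ)
    rw [h0, map_zero] at this
    exact this
  · intro x hx
    have : fderiv ℝ φ x = 0 := by
      by_contra h
      exact hx (h3 (support_fderiv_subset ℝ h))
    simp [gradient, this]

/-- Constants belong to `H¹(Ω)`, with vanishing gradient. -/
theorem const_mem_H1 [IsFiniteMeasure (volume.restrict Ω)] (c : ℝ) :
    ((Lp.const 2 (volume.restrict Ω) c, 0) : L2Pair Ω) ∈ H1 Ω := by
  intro φ hφ
  have h1 : ∫ x in Ω, (Lp.const 2 (volume.restrict Ω) c : Rd d → ℝ) x • gradient φ x =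
      ∫ x in Ω, c • gradient φ x := by
    refine integral_congr_ae ?_
    filter_upwards [Lp.coeFn_const 2 (volume.restrict Ω) c] with x hx
    rw [hx, Function.const_apply]
  have h2 : ∫ x in Ω, φ x • (0 : Lp (Rd d) 2 (volume.restrict Ω)) x = 0 := by
    refine integral_eq_zero_of_ae ?_
    filter_upwards [Lp.coeFn_zero (Rd d) 2 (volume.restrict Ω)] with x hx
    simp only [hx, Pi.zero_apply, smul_zero]
  simp only [h1, h2, integral_smul, hφ.integral_gradient, smul_zero, neg_zero]

theorem gradEnergy_nonneg (p : L2Pair Ω) : 0 ≤ gradEnergy p :=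
  integral_nonneg fun _ => by positivity

theorem gradEnergy_eq_inner (p : L2Pair Ω) :
    gradEnergy p = ∫ x in Ω, inner ℝ (p.2 x) (p.2 x) := by
  simp [gradEnergy]

theorem gradEnergy_eq_norm_sq (p : L2Pair Ω) : gradEnergy p = ‖p.2‖ ^ 2 := by
  rw [gradEnergy_eq_inner, ← real_inner_self_eq_norm_sq, L2.inner_def]

theorem gradEnergy_eq_toReal_lintegral (p : L2Pair Ω) :
    gradEnergy p = (∫⁻ x in Ω, ‖p.2 x‖ₑ ^ 2).toReal := by
  rw [gradEnergy, integral_eq_lintegral_of_nonneg_ae (ae_of_all _ fun _ => by positivity)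
    (by exact (Lp.aestronglyMeasurable p.2).norm.pow 2)]
  simp [ENNReal.ofReal_pow]

theorem lintegral_enorm_sq_ne_top (p : L2Pair Ω) : ∫⁻ x in Ω, ‖p.2 x‖ₑ ^ 2 ≠ ∞ := by
  have := ((Lp.memLp p.2).integrable_norm_pow (p := 2) (by norm_num)).2
  simpa [HasFiniteIntegral] using this.ne

/-- The defect in this inequality is exactly `‖p.2 - q.2‖²`. -/
theorem gradEnergy_sub_le (p q : L2Pair Ω) :
    gradEnergy p - gradEnergy q ≤
      2 * ((∫ x in Ω, inner ℝ (p.2 x) (p.2 x)) - ∫ x in Ω, inner ℝ (p.2 x) (q.2 x)) := by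
  rw [gradEnergy_eq_norm_sq, gradEnergy_eq_norm_sq, ← L2.inner_def, ← L2.inner_def]
  have h := norm_sub_sq_real p.2 q.2
  rw [real_inner_self_eq_norm_sq]
  nlinarith [sq_nonneg ‖p.2 - q.2‖]

theorem integrable_linfty_mul {α : Type*} [MeasurableSpace α] {μ : Measure α} (g : Lp ℝ ⊤ μ)
    {N : ℝ} (hg : ∀ᵐ x ∂μ, |g x| ≤ N) {f : α → ℝ} (hf : Integrable f μ) :
    Integrable (fun x => g x * f x) μ :=
  hf.bdd_mul (Lp.aestronglyMeasurable g) hg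

theorem abs_integral_linfty_mul_le {α : Type*} [MeasurableSpace α] {μ : Measure α} (g : Lp ℝ ⊤ μ)
    {N : ℝ} (hg : ∀ᵐ x ∂μ, |g x| ≤ N) {f : α → ℝ} (hf : Integrable f μ) :
    |∫ x, g x * f x ∂μ| ≤ N * ∫ x, |f x| ∂μ := by
  rw [← integral_const_mul]
  refine (abs_integral_le_integral_abs).trans
    (integral_mono_ae (integrable_linfty_mul g hg hf).abs (hf.abs.const_mul N) ?_)
  filter_upwards [hg] with x hx
  rw [abs_mul]
  gcongr

/-- Convexity of the Dirichlet energy at a point where its `L¹`-slope is attained by `f`. -/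
theorem IsWeakLaplacian.gradEnergy_sub_le [IsFiniteMeasure (volume.restrict Ω)]
    {V : Set (L2Pair Ω)} {p q : L2Pair Ω}
    {g : Lp ℝ ⊤ (volume.restrict Ω)} (hg : IsWeakLaplacian V p g) (hp : p ∈ V) (hq : q ∈ V)
    {f W : Lp ℝ 1 (volume.restrict Ω)} (hgN : ∀ᵐ x ∂(volume.restrict Ω), |g x| ≤ ‖f‖)
    (hfg : ∀ᵐ x ∂(volume.restrict Ω), f x * g x = |f x| * ‖f‖)
    (hW : (fun x => p.1 x - q.1 x) =ᵐ[volume.restrict Ω] W) (τ : ℝ) :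
    gradEnergy p - gradEnergy q ≤ -2 * τ * ‖f‖ ^ 2 + 2 * (‖f‖ * ‖W - τ • f‖) := by
  have hi (r : L2Pair Ω) : Integrable r.1 (volume.restrict Ω) :=
    (Lp.memLp r.1).integrable one_le_two
  have h1 := _root_.gradEnergy_sub_le p q
  rw [hg p hp, hg q hq] at h1
  have hf1 : Integrable f (volume.restrict Ω) := L1.integrable_coeFn f
  have hE1 : Integrable (W - τ • f : Lp ℝ 1 (volume.restrict Ω)) (volume.restrict Ω) :=
    L1.integrable_coeFn _
  -- Splits `p.1 - q.1` as `τ f` plus a remainder: the first part pairs with `g` to `τ ‖f‖²`, the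
  -- second is bounded by `‖g‖_∞ ≤ ‖f‖`.
  have h2 : (∫ x in Ω, g x * p.1 x) - ∫ x in Ω, g x * q.1 x =
      τ * (∫ x in Ω, g x * f x) + ∫ x in Ω, g x * (W - τ • f : Lp ℝ 1 (volume.restrict Ω)) x := by
    rw [← integral_const_mul, ← integral_sub (integrable_linfty_mul g hgN (hi p))
      (integrable_linfty_mul g hgN (hi q)), ← integral_add
      ((integrable_linfty_mul g hgN hf1).const_mul τ) (integrable_linfty_mul g hgN hE1)]
    refine integral_congr_ae ?_
    filter_upwards [hW, Lp.coeFn_sub W (τ • f), Lp.coeFn_smul τ f] with x h1 h2 h3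
    rw [h2, Pi.sub_apply, h3, ← h1, Pi.smul_apply, smul_eq_mul]
    ring
  have h3 : ∫ x in Ω, g x * f x = ‖f‖ ^ 2 := by
    rw [pow_two]
    nth_rw 2 [L1.norm_eq_integral_norm]
    rw [← integral_const_mul]
    refine integral_congr_ae ?_
    filter_upwards [hfg] with x hx
    rw [mul_comm, hx, mul_comm, Real.norm_eq_abs]
  have h4 := abs_integral_linfty_mul_le g hgN hE1
  have h5 : ∫ x in Ω, |(W - τ • f : Lp ℝ 1 (volume.restrict Ω)) x| = ‖W - τ • f‖ := by
    rw [L1.norm_eq_integral_norm]; rfl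
  rw [h5] at h4
  rw [h3] at h2
  linarith [(abs_le.1 h4).1]

/-- Exponential decay along the flow, from a lower bound of the slope by the energy. -/
theorem IsL1DirichletFlow.gradEnergy_le [IsFiniteMeasure (volume.restrict Ω)]
    {V : Set (L2Pair Ω)} {u₀ : L2Pair Ω} {u : ℝ → L2Pair Ω} (hu : IsL1DirichletFlow Ω V u₀ u)
    {k : ℝ} (hk : 0 ≤ k)
    (hV : ∀ p ∈ V, ∀ (g : Lp ℝ ⊤ (volume.restrict Ω)) (N : ℝ), 0 ≤ N → IsWeakLaplacian V p g →
      (∀ᵐ x ∂(volume.restrict Ω), |g x| ≤ N) → k * gradEnergy p ≤ N ^ 2)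
    {t : ℝ} (ht : 0 < t) :
    gradEnergy (u t) ≤ Real.exp (-(t * k)) * gradEnergy u₀ := by
  obtain ⟨v, ⟨hv2, hvd⟩, hflow⟩ := hu.eqn
  have hDc : ContinuousOn (fun t => gradEnergy (u t)) (Ici 0) := by
    simp only [gradEnergy_eq_norm_sq]
    exact (continuous_snd.comp_continuousOn hu.cont).norm.pow 2
  have hvi (a b : ℝ) (ha : 0 < a) (hab : a ≤ b) : IntervalIntegrable v volume a b := by
    rw [intervalIntegrable_iff_integrableOn_Icc_of_le hab]
    exact (hv2 a b ha hab).integrable one_le_two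
  have hslope : ∀ᵐ t ∂(volume.restrict (Ioi (0 : ℝ))), ∀ s, 0 < s → s ≤ t →
      gradEnergy (u t) - gradEnergy (u s) ≤
        -2 * (t - s) * ‖v t‖ ^ 2 + 2 * (‖v t‖ * ∫ r in s..t, ‖v r - v t‖) := by
    filter_upwards [hflow] with t ⟨g, hg, hgN, hvg⟩ s hs hst
    refine (hg.gradEnergy_sub_le (hu.mem t (hs.le.trans hst)) (hu.mem s hs.le) hgN hvg
      (hvd s t hs hst) (t - s)).trans ?_
    gcongr
    -- For `τ = t - s` the remainder is `∫_s^t (v r - v t) dr`.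
    rw [← intervalIntegral.integral_const, ← intervalIntegral.integral_sub (hvi s t hs hst) (by simp)]
    exact intervalIntegral.norm_integral_le_integral_norm hst
  have hdiss (a b : ℝ) (ha : 0 < a) (hab : a ≤ b) :=
    sub_le_neg_two_mul_integral_sq (hDc.mono Ioi_subset_Ici_self) hv2 hslope ha hab
  have hdecay (a : ℝ) (ha : 0 < a) (hat : a ≤ t) :
      gradEnergy (u t) ≤ Real.exp (-(k * (t - a))) * gradEnergy (u a) := by
    refine le_exp_mul_of_dissipation (fun t => gradEnergy_nonneg (u t)) hk
      (ρ := fun t => ‖v t‖ ^ 2) (fun a b ha hab => ?_) ?_ hdiss ha hat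
    · rw [intervalIntegrable_iff_integrableOn_Icc_of_le hab]
      exact (hv2 a b ha hab).integrable_norm_pow (by norm_num)
    · filter_upwards [hflow, ae_restrict_mem measurableSet_Ioi] with t ⟨g, hg, hgN, _⟩ ht
      exact hV (u t) (hu.mem t (le_of_lt ht)) g _ (norm_nonneg _) hg hgN
  -- The equation holds only for positive times, so the decay from time `a > 0` is extended to `a =
  -- 0` by continuity of `u` at 0.
  have hD0 : Tendsto (fun a => gradEnergy (u a)) (𝓝[>] 0) (𝓝 (gradEnergy u₀)) := by
    rw [← hu.init]
    exact ((hDc 0 self_mem_Ici).mono Ioi_subset_Ici_self)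
  have hE : Tendsto (fun a : ℝ => Real.exp (-(k * (t - a)))) (𝓝[>] 0)
      (𝓝 (Real.exp (-(t * k)))) := by
    have : Continuous fun a : ℝ => Real.exp (-(k * (t - a))) := by fun_prop
    simpa [mul_comm] using (this.tendsto 0).mono_left nhdsWithin_le_nhds
  refine ge_of_tendsto (hE.mul hD0) ?_
  filter_upwards [Ioo_mem_nhdsGT ht] with a ha using hdecay a ha.1 ha.2.le

/-! ### Poincaré constants and conclusion -/

/-- Lets the best constant itself serve in the Poincaré inequality. Finiteness of `sInf S` is needed
when `R = 0`: it makes `S` nonempty. -/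
theorem ENNReal.le_sInf_mul {S : Set ℝ≥0∞} {L R : ℝ≥0∞} (hR : R ≠ ∞) (hS : sInf S ≠ ∞)
    (h : ∀ c ∈ S, L ≤ c * R) : L ≤ sInf S * R := by
  rcases eq_or_ne R 0 with rfl | hR0
  · obtain ⟨c, hc⟩ : S.Nonempty := by
      by_contra h
      exact hS (by simp [not_nonempty_iff_eq_empty.1 h])
    simpa using h c hc
  · rw [← ENNReal.div_le_iff hR0 hR]
    exact le_sInf fun c hc => (ENNReal.div_le_iff hR0 hR).2 (h c hc)

/-- A bound of the energy by the slope times an `L¹` norm, combined with a Poincaré inequality with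
best constant `sInf S`, bounds the energy by the squared slope. -/
theorem inv_toReal_mul_gradEnergy_le {S : Set ℝ≥0∞} {p : L2Pair Ω} {f : Rd d → ℝ}
    (hf : Integrable f (volume.restrict Ω)) {N : ℝ}
    (hS : ∀ c ∈ S, (∫⁻ x in Ω, ‖f x‖ₑ) ^ 2 ≤ c * ∫⁻ x in Ω, ‖p.2 x‖ₑ ^ 2)
    (h : gradEnergy p ≤ N * ∫ x in Ω, |f x|) :
    (sInf S)⁻¹.toReal * gradEnergy p ≤ N ^ 2 := by
  -- Both degenerate constants give rate 0: `∞⁻¹ = 0`, and `0⁻¹ = ∞` has `toReal` equal to 0.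
  by_cases hC : sInf S = ∞
  · simp [hC, sq_nonneg]
  by_cases hC0 : sInf S = 0
  · simp [hC0, sq_nonneg]
  have h1 := ENNReal.toReal_mono (ENNReal.mul_ne_top hC (lintegral_enorm_sq_ne_top p))
    (ENNReal.le_sInf_mul (lintegral_enorm_sq_ne_top p) hC hS)
  rw [ENNReal.toReal_mul, ENNReal.toReal_pow, ← gradEnergy_eq_toReal_lintegral,
    ← integral_norm_eq_lintegral_enorm hf.1] at h1
  have hpos : 0 < (sInf S).toReal := ENNReal.toReal_pos hC0 hC
  simp only [Real.norm_eq_abs] at h1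
  rw [ENNReal.toReal_inv, inv_mul_le_iff₀ hpos]
  rcases (gradEnergy_nonneg p).eq_or_lt with h0 | h0
  · rw [← h0]; positivity
  · refine le_of_mul_le_mul_right ?_ h0
    calc gradEnergy p * gradEnergy p ≤ (N * ∫ x in Ω, |f x|) * (N * ∫ x in Ω, |f x|) :=
          mul_self_le_mul_self h0.le h
      _ = N ^ 2 * (∫ x in Ω, |f x|) ^ 2 := by ring
      _ ≤ N ^ 2 * ((sInf S).toReal * gradEnergy p) := by gcongr
      _ = _ := by ring

end Space

theorem mainTheorem6 (d : ℕ) (Ω : Set (Rd d)) (hopen : IsOpen Ω) (hconn : IsConnected Ω)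
    (hbdd : Bornology.IsBounded Ω) :
    (∀ u₀ ∈ H1 Ω, ∀ u : ℝ → L2Pair Ω, IsL1DirichletFlow Ω (H1 Ω) u₀ u → ∀ t : ℝ, 0 < t →
      gradEnergy (u t) ≤
        Real.exp (-(t * (poincareWirtingerConst Ω)⁻¹.toReal)) * gradEnergy u₀) ∧
    (∀ u₀ ∈ H10 Ω, ∀ u : ℝ → L2Pair Ω, IsL1DirichletFlow Ω (H10 Ω) u₀ u → ∀ t : ℝ, 0 < t →
      gradEnergy (u t) ≤
        Real.exp (-(t * (poincareConst Ω)⁻¹.toReal)) * gradEnergy u₀) := by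
  have hfin : IsFiniteMeasure (volume.restrict Ω) :=
    ⟨by simpa using hbdd.measure_lt_top⟩
  have hi (r : L2Pair Ω) : Integrable r.1 (volume.restrict Ω) :=
    (Lp.memLp r.1).integrable one_le_two
  constructor
  · intro u₀ _ u hu t ht
    refine hu.gradEnergy_le ENNReal.toReal_nonneg (fun p hp g N _ hg hgN => ?_) ht
    set m := ⨍ y in Ω, p.1 y
    have hpm : Integrable (fun x => p.1 x - m) (volume.restrict Ω) :=
      (hi p).sub (integrable_const m)
    refine inv_toReal_mul_gradEnergy_le hpm (fun c hc => hc p hp) ?_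
    -- Neumann case: constants are admissible test functions, so the Laplacian has zero integral and
    -- the mean of `p.1` can be subtracted for free.
    have h0 : ∫ x in Ω, g x * m = 0 := by
      have h1 := hg _ (const_mem_H1 m)
      have h2 : ∫ x in Ω, inner ℝ (p.2 x) ((0 : Lp (Rd d) 2 (volume.restrict Ω)) x) = 0 := by
        rw [← L2.inner_def, inner_zero_right]
      have h3 : ∫ x in Ω, g x * (Lp.const 2 (volume.restrict Ω) m : Rd d → ℝ) x =
          ∫ x in Ω, g x * m := by
        refine integral_congr_ae ?_
        filter_upwards [Lp.coeFn_const 2 (volume.restrict Ω) m] with x hx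
        rw [hx, Function.const_apply]
      simp only [h2, h3] at h1
      linarith
    have h4 : ∫ x in Ω, g x * (p.1 x - m) = ∫ x in Ω, g x * p.1 x := by
      simp only [mul_sub]
      rw [integral_sub (integrable_linfty_mul g hgN (hi p))
        (integrable_linfty_mul g hgN (integrable_const m)), h0, sub_zero]
    rw [gradEnergy_eq_inner, hg p hp, ← h4]
    exact (neg_le_abs _).trans (abs_integral_linfty_mul_le g hgN hpm)
  · intro u₀ _ u hu t ht
    refine hu.gradEnergy_le ENNReal.toReal_nonneg (fun p hp g N _ hg hgN => ?_) ht
    refine inv_toReal_mul_gradEnergy_le (hi p) (fun c hc => hc p hp) ?_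
    rw [gradEnergy_eq_inner, hg p hp]
    exact (neg_le_abs _).trans (abs_integral_linfty_mul_le g hgN (hi p))
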